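/- For a nonzero $p(q)=\sum_i a_iq^i\in\mathbb C[q]$ let $d=\operatorname{tdeg}p$ be the sum of the largest and the smallest index $i$ with $a_i\ne0$; $p$ is called palindromic if $a_i=a_{d-i}$ for $0\le i\le d$. Every palindromic $p$ has a unique expansion $p(q)=\sum_{0\le j\le d/2}\gamma_j\,q^j(1+q)^{d-2j}$ with $\gamma_j\in\mathbb C$, and one sets $$\Gamma(p)=\sum_{0\le j\le d/2}\gamma_j\,s^{d-2j}(-t)^j\in\mathbb C[s,t].$$ For $n\ge2$ the cyclotomic polynomial $\Phi_n(q)$ is palindromic. The Lucas atoms are $P_1(s,t)=1$ and $P_n(s,t)=\Gamma(\Phi_n(q))$ for $n\ge2$. Write $\operatorname{sdeg}f$ for the largest power of $s$ occurring in $f(s,t)$, and $\varphi$ for Euler's totient function. **Theorem.** (a) If $n\ge5$ is square-free and $n\equiv1\pmod 4$, then there are polynomials $G_n,H_n\in\mathbb Z[s,t]$ with $$P_n(s,t)=G_n(s,t)^2+n\,t\,H_n(s,t)^2,\qquad \operatorname{sdeg}G_n=\tfrac{\varphi(n)}2,\quad \operatorname{sdeg}H_n=\tfrac{\varphi(n)}2-1.$$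 (b) If $n\ge4$ is even and square-free, then there are polynomials $G_n,H_n\in\mathbb Z[s,t]$ with $$P_{2n}(s,t)=G_n(s,t)^2+n\,t\,H_n(s,t)^2,\qquad \operatorname{sdeg}G_n=\tfrac{\varphi(2n)}2,\quad \operatorname{sdeg}H_n=\tfrac{\varphi(2n)}2-1.$$ -/

import Mathlib

open Polynomial

namespace LucasAtoms

/-- The total degree `deg p + mdeg p`, where `mdeg p` is the least exponent occurring in `p`
(it is `0` for the zero polynomial). -/
noncomputable def tdeg (p : ℂ[X]) : ℕ := p.natDegree + p.natTrailingDegree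

/-- With `d = tdeg p`, the coefficients of `p` satisfy `a_i = a_{d-i}` for `0 ≤ i ≤ d`. The zero
polynomial is allowed, so that `{p | IsPalindromic p}` is the union of the spaces `𝒫_d(q)`. -/
def IsPalindromic (p : ℂ[X]) : Prop :=
  ∀ i ≤ tdeg p, p.coeff i = p.coeff (tdeg p - i)

/-- The polynomial `∑_j γ_j q^j (1+q)^(d-2j)`, with `0 ≤ j ≤ d/2`. -/
noncomputable def gammaExpansion (d : ℕ) (γ : Fin (d / 2 + 1) → ℂ) : ℂ[X] :=
  ∑ j, C (γ j) * (X ^ (j : ℕ) * (1 + X) ^ (d - 2 * (j : ℕ)))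

theorem exists_gammaExpansion_aux (d : ℕ) : ∀ p : ℂ[X], p.natDegree ≤ d →
    (∀ i ≤ d, p.coeff i = p.coeff (d - i)) → ∃ γ, p = gammaExpansion d γ := by
  induction d using Nat.strong_induction_on with
  | _ d ih =>
    intro p hdeg hp
    have hq : ∃ r : ℂ[X], p = C (p.coeff 0) * (1 + X) ^ d + X * r := by
      obtain ⟨r, hr⟩ := (X_dvd_iff (f := p - C (p.coeff 0) * (1 + X) ^ d)).2 (by
        simp [coeff_zero_eq_eval_zero])
      exact ⟨r, by rw [← hr]; ring⟩
    obtain ⟨r, hr⟩ := hq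
    have hc : ∀ i, r.coeff i = p.coeff (i + 1) - p.coeff 0 * (d.choose (i + 1) : ℂ) := by
      intro i
      conv_rhs => rw [hr]
      simp [coeff_X_mul, coeff_one_add_X_pow]
    have hbig : ∀ i, d ≤ i + 1 → r.coeff i = 0 := by
      intro i hi
      rw [hc]
      rcases hi.lt_or_eq with h | h
      · rw [coeff_eq_zero_of_natDegree_lt (lt_of_le_of_lt hdeg h), Nat.choose_eq_zero_of_lt h]
        simp
      · rw [← h, hp 0 (Nat.zero_le d)]
        simp
    by_cases hd : d < 2
    · have hr0 : r = 0 := by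
        ext i
        rw [coeff_zero]
        by_cases hi : d ≤ i + 1
        · exact hbig i hi
        · omega
      refine ⟨fun _ => p.coeff 0, ?_⟩
      have h1 : d / 2 = 0 := by omega
      rw [gammaExpansion, Fin.sum_univ_succ]
      have : IsEmpty (Fin (d / 2)) := by rw [h1]; infer_instance
      conv_lhs => rw [hr, hr0]
      simp
    · obtain ⟨e, rfl⟩ : ∃ e, d = e + 2 := ⟨d - 2, by omega⟩
      obtain ⟨γ, hγ⟩ := ih e (by omega) r
        (natDegree_le_iff_coeff_eq_zero.2 fun i hi => hbig i (by omega)) (by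
          intro i hi
          rw [hc, hc, hp (i + 1) (by omega), show e + 2 - (i + 1) = e - i + 1 by omega,
            ← Nat.choose_symm (show i + 1 ≤ e + 2 by omega),
            show e + 2 - (i + 1) = e - i + 1 by omega])
      have h1 : (e + 2) / 2 + 1 = e / 2 + 1 + 1 := by omega
      have h2 : ∀ m (hm : m = e / 2 + 1 + 1), ∃ δ : Fin m → ℂ,
          p = ∑ j, C (δ j) * (X ^ (j : ℕ) * (1 + X) ^ (e + 2 - 2 * (j : ℕ))) := by
        rintro m rfl
        refine ⟨Fin.cons (p.coeff 0) γ, ?_⟩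
        have h3 : X * r = ∑ j : Fin (e / 2 + 1), C (γ j) *
            (X ^ ((j : ℕ) + 1) * (1 + X) ^ (e + 2 - 2 * ((j : ℕ) + 1))) := by
          rw [hγ, gammaExpansion, Finset.mul_sum]
          refine Finset.sum_congr rfl fun j _ => ?_
          rw [show e + 2 - 2 * ((j : ℕ) + 1) = e - 2 * (j : ℕ) by omega]
          ring
        rw [Fin.sum_univ_succ]
        simp only [Fin.cons_zero, Fin.cons_succ, Fin.val_zero, Fin.val_succ, pow_zero, one_mul,
          mul_zero, tsub_zero]
        rw [← h3]
        exact hr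
      exact h2 _ h1

theorem gammaExpansion_injective (d : ℕ) : Function.Injective (gammaExpansion d) := by
  intro γ δ h
  have key : ∀ k (hk : k < d / 2 + 1), γ ⟨k, hk⟩ = δ ⟨k, hk⟩ := by
    intro k
    induction k using Nat.strong_induction_on with
    | _ k ih =>
      intro hk
      have h2 : gammaExpansion d (fun j => γ j - δ j) = 0 := by
        rw [← sub_eq_zero.2 h]
        simp only [gammaExpansion, C_sub, sub_mul, Finset.sum_sub_distrib]
      have h3 := congrArg (fun p => coeff p k) h2
      simp only [gammaExpansion, finsetSum_coeff, coeff_C_mul, coeff_zero] at h3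
      rw [Finset.sum_eq_single_of_mem ⟨k, hk⟩ (Finset.mem_univ _)] at h3
      · rw [coeff_X_pow_mul', if_pos le_rfl] at h3
        simpa [coeff_one_add_X_pow, sub_eq_zero] using h3
      · intro j _ hj
        rcases lt_trichotomy (j : ℕ) k with hlt | heq | hgt
        · rw [ih j hlt j.2, sub_self, zero_mul]
        · exact absurd (Fin.ext heq) hj
        · rw [coeff_X_pow_mul', if_neg (by simpa using hgt), mul_zero]
  funext j
  exact key j j.2

/-- Every palindromic polynomial has unique gamma coefficients. -/
theorem existsUnique_gammaExpansion {p : ℂ[X]} (hp : IsPalindromic p) :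
    ∃! γ : Fin (tdeg p / 2 + 1) → ℂ, p = gammaExpansion (tdeg p) γ := by
  obtain ⟨γ, hγ⟩ := exists_gammaExpansion_aux (tdeg p) p (Nat.le_add_right _ _) hp
  exact ⟨γ, hγ, fun δ hδ => gammaExpansion_injective _ (hδ.symm.trans hγ)⟩

/-- The gamma coefficients of a palindromic polynomial. -/
noncomputable def gammaCoeff (p : ℂ[X]) (hp : IsPalindromic p) : Fin (tdeg p / 2 + 1) → ℂ :=
  (existsUnique_gammaExpansion hp).choose

/-- The variable `s`. -/
noncomputable abbrev s : MvPolynomial (Fin 2) ℂ := MvPolynomial.X 0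

/-- The variable `t`. -/
noncomputable abbrev t : MvPolynomial (Fin 2) ℂ := MvPolynomial.X 1

open Classical in
/-- The map `Γ`, which sends a palindromic `p = ∑_j γ_j q^j (1+q)^(d-2j)` with `d = tdeg p` to
`∑_j γ_j s^(d-2j) (-t)^j`. It is only used on palindromic polynomials. -/
noncomputable def Gamma (p : ℂ[X]) : MvPolynomial (Fin 2) ℂ :=
  if hp : IsPalindromic p then
    ∑ j, MvPolynomial.C (gammaCoeff p hp j) * s ^ (tdeg p - 2 * (j : ℕ)) * (-t) ^ (j : ℕ)
  else 0

/-- For `n ≥ 2` the cyclotomic polynomial `Φ_n` is palindromic. -/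
theorem isPalindromic_cyclotomic {n : ℕ} (hn : 2 ≤ n) : IsPalindromic (cyclotomic n ℂ) := by
  have hn0 : n ≠ 0 := by omega
  have h0 : (cyclotomic n ℤ).coeff 0 = 1 := cyclotomic_coeff_zero ℤ hn
  have htr : (cyclotomic n ℤ).natTrailingDegree = 0 :=
    natTrailingDegree_eq_zero.2 (Or.inr (by rw [h0]; exact one_ne_zero))
  have hζ := Complex.isPrimitiveRoot_exp n hn0
  set ζ := Complex.exp (2 * Real.pi * Complex.I / n)
  have hroot : aeval ζ⁻¹ (cyclotomic n ℤ) = 0 := by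
    have := hζ.inv.isRoot_cyclotomic (Nat.pos_of_ne_zero hn0)
    rwa [← map_cyclotomic_int n ℂ, IsRoot.def, eval_map] at this
  have hdvd : cyclotomic n ℤ ∣ (cyclotomic n ℤ).reverse := by
    rw [cyclotomic_eq_minpoly hζ (Nat.pos_of_ne_zero hn0)]
    refine minpoly.isIntegrallyClosed_dvd (hζ.isIntegral (Nat.pos_of_ne_zero hn0)) ?_
    rw [← cyclotomic_eq_minpoly hζ (Nat.pos_of_ne_zero hn0)]
    let _ : Invertible ζ⁻¹ := invertibleOfNonzero (inv_ne_zero (hζ.ne_zero hn0))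
    have := (eval₂_reverse_eq_zero_iff (algebraMap ℤ ℂ) ζ⁻¹ (cyclotomic n ℤ)).2 hroot
    simpa [aeval_def] using this
  have hrev : (cyclotomic n ℤ).reverse = cyclotomic n ℤ := by
    refine (eq_of_monic_of_dvd_of_natDegree_le (cyclotomic.monic n ℤ) ?_ hdvd
      (reverse_natDegree_le _))
    rw [Monic, reverse_leadingCoeff, trailingCoeff, htr, h0]
  have htr' : (cyclotomic n ℂ).natTrailingDegree = 0 :=
    natTrailingDegree_eq_zero.2 (Or.inr (by rw [cyclotomic_coeff_zero ℂ hn]; exact one_ne_zero))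
  intro i hi
  rw [tdeg, htr', add_zero, natDegree_cyclotomic] at hi ⊢
  rw [← map_cyclotomic_int n ℂ, coeff_map, coeff_map]
  conv_lhs => rw [← hrev]
  rw [coeff_reverse, natDegree_cyclotomic, revAt_le hi]

/-- The Lucas atoms: `P_1 = 1` and `P_n = Γ(Φ_n)` for `n ≥ 2`. (`P_0` is not meaningful.) -/
noncomputable def lucasAtom (n : ℕ) : MvPolynomial (Fin 2) ℂ :=
  if n = 1 then 1 else Gamma (cyclotomic n ℂ)

/-- The largest power of `s` occurring in an integral polynomial in `s, t`. -/
noncomputable def sdeg (f : MvPolynomial (Fin 2) ℤ) : ℕ := f.degreeOf 0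

end LucasAtoms

/-!
Let `N = n` in the first case and `N = 2n` in the second, and let `E = φ(N) / 2`. Writing
`v = (1 + ζ)² / ζ = ζ + ζ⁻¹ + 2` for a primitive `N`-th root of unity `ζ`, the gamma coefficients
of `Φ_N` are the coefficients of the minimal polynomial `p` of `v`, which has degree `E`
(`cyclotomic_eq_sum_coeff_minpoly`). So `P_N(s, t)` is the homogenization of `p(x²)` with
`x² = s² / (-t)`, and the theorem says that `p(x²) = g(x)² - n h(x)²` with `g`, `h` integral.

Such a factorization over `ℚ(√n)` exists because `ℚ(ζ)` contains a square root `w` of `nζ`, for a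
suitable `ζ`; it comes from quadratic Gauss sums (`exists_sq_eq_of_odd`) and, for even `n`, from
`(1 + i)² = 2i`. The real number `u = w + n / w` satisfies `u² = n v` and lies in the maximal real
subfield of `ℚ(ζ)`, so it has degree only `E` as well (`two_mul_natDegree_minpoly`), whereas
`p(z² / n)` has degree `2E`. Hence its minimal polynomial `f` satisfies
`f(z) f(-z) = (-n)^E p(z² / n)` (`aeval_mul_aeval_neg`), and `g(x) ± √n h(x)` is
`f(± √n x) / (± √n)^E`. The coefficients of `g` and `h` are integers because `g + √n h` is a monic
divisor of `p(x²)` and `n` is squarefree (`exists_coeff_minpoly_eq`).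

The leading coefficient of `g` is `1`, which gives the degree of `G` in `s`. That the coefficient
of `x^(E-1)` in `h` is nonzero follows from the parity of the coefficients of `q` and `q²` in `Φ_N`
(`subleading_ne_zero`).
-/

namespace LucasAtoms

/-! ### Square roots in cyclotomic fields -/

open IntermediateField in
theorem mem_adjoin_of_pow_eq_one {N : ℕ} [NeZero N] {ζ : ℂ} (hζ : IsPrimitiveRoot ζ N) {z : ℂ}
    (hz : z ^ N = 1) : z ∈ ℚ⟮ζ⟯ := by
  obtain ⟨i, -, rfl⟩ := hζ.eq_pow_of_pow_eq_one hz
  exact pow_mem (mem_adjoin_simple_self ℚ ζ) i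

/-- The prime case is the quadratic Gauss sum. -/
theorem exists_sq_eq_of_prime (K : IntermediateField ℚ ℂ) {p : ℕ} (hp : p.Prime) (hodd : Odd p)
    (hK : ∀ z : ℂ, z ^ p = 1 → z ∈ K) : ∃ g ∈ K, g ^ 2 = ((ZMod.χ₄ (p : ZMod 4) : ℤ) : ℂ) * p := by
  have : Fact p.Prime := ⟨hp⟩
  have hp2 : ringChar (ZMod p) ≠ 2 := by
    rw [ZMod.ringChar_zmod_n]
    rintro rfl
    exact absurd hodd (by decide)
  have hζ := Complex.isPrimitiveRoot_exp p hp.ne_zero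
  set ζ := Complex.exp (2 * Real.pi * Complex.I / p)
  set χ : MulChar (ZMod p) ℂ := (quadraticChar (ZMod p)).ringHomComp (Int.castRingHom ℂ) with hχ
  refine ⟨gaussSum χ (AddChar.zmodChar p hζ.pow_eq_one), ?_, ?_⟩
  · refine sum_mem fun a _ => mul_mem ?_ ?_
    · rw [hχ, MulChar.ringHomComp_apply]
      exact intCast_mem K _
    · refine hK _ ?_
      rw [AddChar.zmodChar_apply, ← pow_mul, mul_comm, pow_mul, hζ.pow_eq_one, one_pow]
  · have hne : χ ≠ 1 := by
      rw [hχ, MulChar.ringHomComp_ne_one_iff (RingHom.injective_int _)]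
      exact quadraticChar_ne_one hp2
    have hq : χ.IsQuadratic := (quadraticChar_isQuadratic (ZMod p)).comp _
    rw [gaussSum_sq hne hq (AddChar.zmodChar_primitive_of_primitive_root p hζ), hχ,
      MulChar.ringHomComp_apply, quadraticChar_neg_one hp2, ZMod.card]
    rfl

/-- The square root of `(-1)^((m-1)/2) m` lies in the field of `m`-th roots of unity. -/
theorem exists_sq_eq_of_odd (K : IntermediateField ℚ ℂ) (m : ℕ) (hodd : Odd m)
    (hK : ∀ z : ℂ, z ^ m = 1 → z ∈ K) : ∃ g ∈ K, g ^ 2 = ((ZMod.χ₄ (m : ZMod 4) : ℤ) : ℂ) * m := by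
  induction m using induction_on_primes with
  | zero => exact absurd hodd (by decide)
  | one => exact ⟨1, one_mem K, by simp⟩
  | prime_mul p a hp ih =>
    obtain ⟨hpo, hao⟩ := Nat.odd_mul.1 hodd
    obtain ⟨g, hg, hg2⟩ := exists_sq_eq_of_prime K hp hpo fun z hz =>
      hK z (by rw [pow_mul, hz, one_pow])
    obtain ⟨h, hh, hh2⟩ := ih hao fun z hz => hK z (by rw [mul_comm, pow_mul, hz, one_pow])
    refine ⟨g * h, mul_mem hg hh, ?_⟩
    rw [mul_pow, hg2, hh2]
    push_cast
    rw [map_mul]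
    push_cast
    ring

open IntermediateField in
theorem exists_sq_eq_mul_root_of_mod_four_eq_one {n : ℕ} (hn : n % 4 = 1) :
    ∃ ζ w : ℂ, IsPrimitiveRoot ζ n ∧ w ∈ ℚ⟮ζ⟯ ∧ w ^ 2 = n * ζ := by
  have : NeZero n := ⟨by omega⟩
  have hζ := Complex.isPrimitiveRoot_exp n (NeZero.ne n)
  set ζ := Complex.exp (2 * Real.pi * Complex.I / n)
  obtain ⟨g, hg, hg2⟩ := exists_sq_eq_of_odd ℚ⟮ζ⟯ n (Nat.odd_iff.2 (by omega))
    fun z hz => mem_adjoin_of_pow_eq_one hζ hz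
  -- `g² = n`, and `ζ ^ ((n + 1) / 2)` is a square root of `ζ` because `n` is odd.
  refine ⟨ζ, g * ζ ^ ((n + 1) / 2), hζ, mul_mem hg (pow_mem (mem_adjoin_simple_self ℚ ζ) _), ?_⟩
  rw [mul_pow, hg2, ZMod.χ₄_nat_one_mod_four hn, ← pow_mul, Nat.div_mul_cancel (by omega),
    pow_succ, hζ.pow_eq_one]
  simp

open IntermediateField in
/-- Here `w = (1 + i) g η`, where `g² = ± m` and `η` is a primitive `m`-th root of unity. -/
theorem exists_sq_eq_mul_root_of_even {m : ℕ} (hm : Odd m) :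
    ∃ ζ w : ℂ, IsPrimitiveRoot ζ (4 * m) ∧ w ∈ ℚ⟮ζ⟯ ∧ w ^ 2 = ((2 * m : ℕ) : ℂ) * ζ := by
  have hm0 : m ≠ 0 := by rintro rfl; exact absurd hm (by decide)
  have : NeZero (4 * m) := ⟨by omega⟩
  have hη := Complex.isPrimitiveRoot_exp m hm0
  set η := Complex.exp (2 * Real.pi * Complex.I / m)
  obtain ⟨ε, hε, hε4⟩ : ∃ ε : ℂ, ε ^ 2 = 1 ∧ ((ZMod.χ₄ (m : ZMod 4) : ℤ) : ℂ) = ε := by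
    refine ⟨_, ?_, rfl⟩
    obtain h | h : m % 4 = 1 ∨ m % 4 = 3 := by have := Nat.odd_iff.1 hm; omega
    · simp [ZMod.χ₄_nat_one_mod_four h]
    · simp [ZMod.χ₄_nat_three_mod_four h]
  -- The sign `ε` has to be absorbed into `ζ`: the square of `(1 + i) g η` is `2m · ε i η²`.
  have hI : IsPrimitiveRoot (ε * Complex.I) 4 := by
    refine (IsPrimitiveRoot.iff (by decide)).2 ⟨?_, fun l hl hl4 h => ?_⟩
    · rw [mul_pow, Complex.I_pow_four, show ε ^ 4 = (ε ^ 2) ^ 2 by ring, hε]; norm_num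
    · have h2 : (ε * Complex.I) ^ 2 = -1 := by rw [mul_pow, hε, Complex.I_sq]; norm_num
      interval_cases l
      · rw [pow_one] at h; rw [h] at h2; norm_num at h2
      · rw [h2] at h; norm_num at h
      · rw [pow_succ, h2] at h
        rw [show ε * Complex.I = -1 by linear_combination -h] at h2
        norm_num at h2
  have hη2 : IsPrimitiveRoot (η ^ 2) m := hη.pow_of_coprime 2 (Nat.coprime_two_left.2 hm)
  have hζ : IsPrimitiveRoot (ε * Complex.I * η ^ 2) (4 * m) := by
    have hco : Nat.Coprime 4 m := Nat.Coprime.pow_left 2 (Nat.coprime_two_left.2 hm)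
    have h := (Commute.all (ε * Complex.I) (η ^ 2)).orderOf_mul_eq_mul_orderOf_of_coprime
      (by rwa [← hI.eq_orderOf, ← hη2.eq_orderOf])
    rw [← hI.eq_orderOf, ← hη2.eq_orderOf] at h
    rw [← h]
    exact IsPrimitiveRoot.orderOf _
  obtain ⟨g, hg, hg2⟩ := exists_sq_eq_of_odd ℚ⟮ε * Complex.I * η ^ 2⟯ m hm fun z hz =>
    mem_adjoin_of_pow_eq_one hζ (by rw [mul_comm, pow_mul, hz, one_pow])
  refine ⟨_, (1 + Complex.I) * g * η, hζ, mul_mem (mul_mem (add_mem (one_mem _) ?_) hg) ?_, ?_⟩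
  · exact mem_adjoin_of_pow_eq_one hζ (by rw [pow_mul, Complex.I_pow_four, one_pow])
  · exact mem_adjoin_of_pow_eq_one hζ (by rw [mul_comm, pow_mul, hη.pow_eq_one, one_pow])
  · rw [mul_pow, mul_pow, hg2, hε4]
    push_cast
    linear_combination ε * m * η ^ 2 * Complex.I_sq

/-! ### Degrees over the rationals of real cyclotomic numbers -/

open IntermediateField in
theorem natDegree_minpoly_mul {F E : Type*} [Field F] [Field E] [Algebra F E] {x y : E}
    (hy : IsIntegral F y) (hx : x ∈ F⟮y⟯) :
    (minpoly F x).natDegree * (minpoly F⟮x⟯ y).natDegree = (minpoly F y).natDegree := by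
  have : FiniteDimensional F F⟮y⟯ := adjoin.finiteDimensional hy
  have hxint : IsIntegral F x := (IsIntegral.of_finite F (⟨x, hx⟩ : F⟮y⟯)).map (F⟮y⟯).val
  have hres : restrictScalars F F⟮x⟯⟮y⟯ = F⟮y⟯ := by
    rw [restrictScalars_adjoin_eq_sup, sup_eq_right.2 (adjoin_simple_le_iff.2 hx)]
  have h := Module.finrank_mul_finrank F F⟮x⟯ F⟮x⟯⟮y⟯
  rw [adjoin.finrank hy.tower_top, adjoin.finrank hxint] at h
  rw [h, ← adjoin.finrank hy, ← hres]
  rfl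

open IntermediateField in
/-- The degree of a generator of the real subfield of the `N`-th cyclotomic field: the root of
unity `ζ` is quadratic over `ℚ(x)`, because it is not real and `ζ + ζ⁻¹` lies in `ℚ(x)`. -/
theorem two_mul_natDegree_minpoly {N : ℕ} (hN : 3 ≤ N) {ζ : ℂ} (hζ : IsPrimitiveRoot ζ N) {x : ℂ}
    (hx : x ∈ ℚ⟮ζ⟯) (hreal : x ∈ Set.range ((↑) : ℝ → ℂ))
    (hv : ζ + ζ⁻¹ ∈ ℚ⟮x⟯) :
    2 * (minpoly ℚ x).natDegree = N.totient := by
  have hN0 : 0 < N := by omega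
  have hζ0 : ζ ≠ 0 := hζ.ne_zero hN0.ne'
  have hζint : IsIntegral ℚ ζ := (hζ.isIntegral hN0).tower_top
  have hR : ∀ y ∈ ℚ⟮x⟯, ∃ r : ℝ, (r : ℂ) = y := by
    have : ℚ⟮x⟯ ≤ (Complex.ofRealAm.restrictScalars ℚ).fieldRange := by
      rw [adjoin_simple_le_iff]
      obtain ⟨r, rfl⟩ := hreal
      exact ⟨r, rfl⟩
    intro y hy
    obtain ⟨r, hr⟩ := this hy
    exact ⟨r, hr⟩
  have hnot : ζ ∉ ℚ⟮x⟯ := by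
    intro h
    obtain ⟨r, hr⟩ := hR ζ h
    have h1 : r ^ N = 1 := by
      have := hζ.pow_eq_one
      rw [← hr] at this
      exact_mod_cast this
    have h2 : r ^ 2 = 1 := by
      have habs : |r| = 1 := by
        rw [← pow_eq_one_iff_of_nonneg (abs_nonneg r) hN0.ne', ← abs_pow, h1, abs_one]
      rw [← sq_abs, habs, one_pow]
    have h3 : ζ ^ 2 = 1 := by rw [← hr]; exact_mod_cast h2
    have := Nat.le_of_dvd (by decide) (hζ.dvd_of_pow_eq_one 2 h3)
    omega
  have hdeg : (minpoly ℚ⟮x⟯ ζ).natDegree = 2 := by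
    have hζx : IsIntegral ℚ⟮x⟯ ζ := hζint.tower_top
    refine le_antisymm ?_ ?_
    · let q : ℚ⟮x⟯[X] := X ^ 2 - C ⟨ζ + ζ⁻¹, hv⟩ * X + 1
      have hq : q.natDegree = 2 := by simp only [q]; compute_degree!
      have hq0 : q ≠ 0 := by rintro h; rw [h] at hq; simp at hq
      rw [← hq]
      refine natDegree_le_of_dvd (minpoly.dvd _ _ ?_) hq0
      simp only [q, map_add, map_sub, map_mul, map_pow, aeval_X, aeval_C, map_one]
      rw [show algebraMap ℚ⟮x⟯ ℂ ⟨ζ + ζ⁻¹, hv⟩ = ζ + ζ⁻¹ from rfl]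
      field_simp
      ring
    · rw [minpoly.two_le_natDegree_iff hζx]
      rintro ⟨y, hy⟩
      exact hnot (hy ▸ y.2)
  have h1 := natDegree_minpoly_mul hζint hx
  rw [hdeg, ← cyclotomic_eq_minpoly_rat hζ hN0, natDegree_cyclotomic] at h1
  omega

/-! ### Conjugate factors over `ℚ(√n)` and their integrality -/

theorem exists_eq_expand_two {M : ℚ[X]} (h : M.comp (-X) = M) : ∃ R : ℚ[X], M = expand ℚ 2 R := by
  refine ⟨contract 2 M, ?_⟩
  ext k
  rw [coeff_expand two_pos]
  split_ifs with hk
  · rw [coeff_contract two_ne_zero, Nat.div_mul_cancel hk]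
  · have h1 := congrArg (fun q => coeff q k) h
    have h2 : (M.comp (-X)).coeff k = (-1) ^ k * M.coeff k := by
      rw [show (-X : ℚ[X]) = C (-1) * X by simp, comp_C_mul_X_coeff, mul_comm]
    simp only [h2, (Nat.not_even_iff_odd.1 fun h => hk h.two_dvd).neg_one_pow] at h1
    linarith

/-- The minimal polynomials `f` of `u` and `p` of `u² / n`, when they have the same degree, satisfy
`f(z) f(-z) = (-n)^E p(z² / n)`. -/
theorem aeval_mul_aeval_neg {E n : ℕ} (hn : n ≠ 0) {u v : ℂ} (hu : IsIntegral ℚ u)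
    (huv : u ^ 2 = n * v) (hfE : (minpoly ℚ u).natDegree = E) (hpE : (minpoly ℚ v).natDegree = E)
    {σ : ℂ} (hσ : σ ^ 2 = n) (x : ℂ) :
    aeval (σ * x) (minpoly ℚ u) * aeval (-(σ * x)) (minpoly ℚ u) =
      (-n) ^ E * aeval (x ^ 2) (minpoly ℚ v) := by
  set f := minpoly ℚ u
  have hf : f.Monic := minpoly.monic hu
  have hn' : (n : ℚ) ≠ 0 := Nat.cast_ne_zero.2 hn
  have hv : IsIntegral ℚ v := by
    have h1 : v = (algebraMap ℚ ℂ (n : ℚ)⁻¹) * u ^ 2 := by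
      rw [huv]
      have : (n : ℂ) ≠ 0 := Nat.cast_ne_zero.2 hn
      push_cast [eq_ratCast]
      field_simp
    rw [h1]
    exact isIntegral_algebraMap.mul (hu.pow 2)
  -- `f(z) f(-z) = R(z²)`, and `R(n x)` vanishes at `v`, so it is a multiple of `p`.
  obtain ⟨R, hR⟩ := exists_eq_expand_two (M := f * f.comp (-X)) (by
    rw [mul_comp, comp_assoc, neg_comp, X_comp, neg_neg, comp_X, mul_comm])
  have hRz : ∀ z : ℂ, aeval z f * aeval (-z) f = aeval (z ^ 2) R := by
    intro z
    rw [← expand_aeval, ← hR, map_mul, aeval_comp]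
    simp
  have hcomp : (f.comp (-X)).natDegree = E := by rw [natDegree_comp]; simp [hfE]
  have hlead : (f.comp (-X)).leadingCoeff = (-1) ^ E := by
    rw [leadingCoeff_comp (by simp), hf.leadingCoeff, hfE]; simp
  have hcomp0 : f.comp (-X) ≠ 0 := by
    rw [← leadingCoeff_ne_zero, hlead]; exact pow_ne_zero _ (by norm_num)
  have hRE : R.natDegree = E := by
    have h1 := congrArg natDegree hR
    rw [natDegree_mul hf.ne_zero hcomp0, hcomp, hfE, natDegree_expand] at h1
    omega
  have hRlead : R.leadingCoeff = (-1) ^ E := by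
    have h1 := congrArg leadingCoeff hR
    rw [leadingCoeff_mul, hlead, hf.leadingCoeff, one_mul, leadingCoeff_expand two_pos] at h1
    exact h1.symm
  have hS : R.comp (C (n : ℚ) * X) = C ((-n : ℚ) ^ E) * minpoly ℚ v := by
    have hdeg : (R.comp (C (n : ℚ) * X)).natDegree = E := by
      rw [natDegree_comp, natDegree_C_mul_X _ hn', mul_one, hRE]
    have hl : (R.comp (C (n : ℚ) * X)).leadingCoeff = (-n) ^ E := by
      rw [leadingCoeff_comp (by rw [natDegree_C_mul_X _ hn']; exact one_ne_zero), hRlead, hRE,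
        leadingCoeff_C_mul_X, ← mul_pow]
      simp
    have hc0 : (-n : ℚ) ^ E ≠ 0 := pow_ne_zero _ (neg_ne_zero.2 hn')
    have hmonic : (C ((-n : ℚ) ^ E)⁻¹ * R.comp (C (n : ℚ) * X)).Monic := by
      rw [Monic, leadingCoeff_mul, leadingCoeff_C, hl, inv_mul_cancel₀ hc0]
    have hroot : aeval v (C ((-n : ℚ) ^ E)⁻¹ * R.comp (C (n : ℚ) * X)) = 0 := by
      rw [map_mul, aeval_comp]
      have : aeval v (C (n : ℚ) * X) = u ^ 2 := by simp [huv]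
      rw [this, ← hRz, minpoly.aeval, zero_mul, mul_zero]
    have := eq_of_monic_of_dvd_of_natDegree_le (minpoly.monic hv) hmonic (minpoly.dvd _ _ hroot) (by
      rw [natDegree_C_mul (inv_ne_zero hc0), hdeg, hpE])
    rw [← this, ← mul_assoc, ← C_mul, mul_inv_cancel₀ hc0, C_1, one_mul]
  have h1 := congrArg (aeval (x ^ 2)) hS
  rw [aeval_comp, map_mul _ (C ((-n : ℚ) ^ E)), aeval_C] at h1
  rw [hRz, mul_pow, hσ, show (n : ℂ) * x ^ 2 = aeval (x ^ 2) (C (n : ℚ) * X) by simp, h1]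
  simp

theorem exists_intCast_eq {r : ℚ} (h : IsIntegral ℤ (r : ℂ)) : ∃ a : ℤ, r = a := by
  have h1 : IsIntegral ℤ r := (isIntegral_algebraMap_iff (A := ℚ) (B := ℂ)
    (algebraMap ℚ ℂ).injective).1 (by simpa using h)
  obtain ⟨a, ha⟩ := IsIntegrallyClosed.isIntegral_iff.1 h1
  exact ⟨a, by simp [← ha]⟩

/-- If `r √n` is an algebraic integer with `r` rational and `n` squarefree, then `r` is an
integer. -/
theorem exists_intCast_eq_of_isIntegral_mul {n : ℕ} (hn : Squarefree n) {σ : ℂ} (hσ : σ ^ 2 = n)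
    {r : ℚ} (h : IsIntegral ℤ (r * σ)) : ∃ a : ℤ, r = a := by
  have hn0 : (n : ℚ) ≠ 0 := Nat.cast_ne_zero.2 hn.ne_zero
  obtain ⟨b, hb⟩ := exists_intCast_eq (r := r ^ 2 * n) (by
    have := h.pow 2
    rw [mul_pow, hσ] at this
    exact_mod_cast this)
  obtain ⟨d, hd⟩ := exists_intCast_eq (r := r * n) (by
    refine IsIntegral.of_pow two_pos ?_
    have : (((r * n : ℚ) : ℂ)) ^ 2 = ((b * n : ℤ) : ℂ) := by
      have : (r * n) ^ 2 = ((b * n : ℤ) : ℚ) := by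
        push_cast
        rw [← hb]
        ring
      exact_mod_cast this
    rw [this]
    exact isIntegral_algebraMap (R := ℤ) (A := ℂ))
  have h1 : d ^ 2 = n * b := by
    have : (d : ℚ) ^ 2 = n * b := by rw [← hd, ← hb]; ring
    exact_mod_cast this
  obtain ⟨a, ha⟩ := ((Int.squarefree_natCast.2 hn).dvd_pow_iff_dvd two_ne_zero).1 ⟨b, h1⟩
  refine ⟨a, mul_right_cancel₀ hn0 ?_⟩
  rw [hd, ha]
  push_cast
  ring

/-- Since `f(√n x)` divides `p(x²)` up to a constant factor, its coefficients are algebraic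
integers after division by the leading coefficient. -/
theorem exists_coeff_minpoly_eq {E n : ℕ} (hn : Squarefree n) {u v : ℂ} (hu : IsIntegral ℚ u)
    (hv : IsIntegral ℤ v) (huv : u ^ 2 = n * v) (hfE : (minpoly ℚ u).natDegree = E)
    (hpE : (minpoly ℚ v).natDegree = E) :
    ∃ a : ℕ → ℤ, ∀ k ≤ E, (minpoly ℚ u).coeff (E - k) = a k * n ^ ((k + 1) / 2) := by
  have hn0 : (n : ℂ) ≠ 0 := Nat.cast_ne_zero.2 hn.ne_zero
  have hnq : (n : ℚ) ≠ 0 := Nat.cast_ne_zero.2 hn.ne_zero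
  obtain ⟨σ, hσ⟩ := IsAlgClosed.exists_pow_nat_eq (n : ℂ) two_pos
  have hσ0 : σ ≠ 0 := by rintro rfl; exact hn0 (by simpa using hσ.symm)
  set f := minpoly ℚ u with hf
  let F : ℂ[X] := C (σ ^ E)⁻¹ * (f.map (algebraMap ℚ ℂ)).comp (C σ * X)
  let F' : ℂ[X] := C ((-σ) ^ E)⁻¹ * (f.map (algebraMap ℚ ℂ)).comp (C (-σ) * X)
  have hFmonic : F.Monic := by
    rw [Monic, leadingCoeff_mul, leadingCoeff_C,
      leadingCoeff_comp (by rw [natDegree_C_mul_X _ hσ0]; exact one_ne_zero), leadingCoeff_map,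
      (minpoly.monic hu).leadingCoeff, natDegree_map, hfE, leadingCoeff_C_mul_X, map_one, one_mul,
      inv_mul_cancel₀ (pow_ne_zero _ hσ0)]
  have hprod : ((expand ℤ 2 (minpoly ℤ v)).map (algebraMap ℤ ℂ)) = F * F' := by
    refine Polynomial.funext fun x => ?_
    have h1 := aeval_mul_aeval_neg hn.ne_zero hu huv hfE hpE hσ x
    rw [eval_map_algebraMap, expand_aeval]
    have h2 : aeval (x ^ 2) (minpoly ℚ v) = aeval (x ^ 2) (minpoly ℤ v) := by
      rw [minpoly.isIntegrallyClosed_eq_field_fractions' ℚ hv, aeval_map_algebraMap]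
    rw [h2] at h1
    simp only [F, F', eval_mul, eval_C, eval_comp, eval_X, eval_map_algebraMap]
    have h3 : (σ ^ E) * (-σ) ^ E = (-n) ^ E := by rw [← mul_pow, ← hσ]; ring
    have h4 : (-σ) ^ E ≠ 0 := pow_ne_zero _ (neg_ne_zero.2 hσ0)
    have h5 : σ ^ E ≠ 0 := pow_ne_zero _ hσ0
    rw [← h3, show -(σ * x) = -σ * x by ring] at h1
    rw [mul_mul_mul_comm, ← mul_inv, h1, inv_mul_cancel_left₀ (mul_ne_zero h5 h4)]
  have hint : ∀ k, IsIntegral ℤ (F.coeff k) := by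
    intro k
    have h1 := integralClosure.mem_lifts_of_monic_of_dvd_map ℂ ((minpoly.monic hv).expand two_pos)
      hFmonic ⟨F', hprod⟩
    obtain ⟨q, hq⟩ := (mem_lifts _).1 h1
    rw [← hq, coeff_map]
    exact (q.coeff k).2
  have key : ∀ k ≤ E, ∃ a : ℤ, f.coeff (E - k) = a * n ^ ((k + 1) / 2) := by
    intro k hk
    suffices h : ∃ a : ℤ, f.coeff (E - k) / n ^ ((k + 1) / 2) = a by
      obtain ⟨a, ha⟩ := h
      exact ⟨a, (div_eq_iff (pow_ne_zero _ hnq)).1 ha⟩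
    have h1 := hint (E - k)
    have h2 : F.coeff (E - k) = (f.coeff (E - k) : ℂ) * (σ ^ k)⁻¹ := by
      simp only [F, coeff_C_mul, comp_C_mul_X_coeff, coeff_map, eq_ratCast]
      have : σ ^ E = σ ^ k * σ ^ (E - k) := by rw [← pow_add, Nat.add_sub_cancel' hk]
      rw [this]
      field_simp
    rw [h2] at h1
    obtain ⟨j, rfl | rfl⟩ := Nat.even_or_odd' k
    · refine exists_intCast_eq ?_
      rw [pow_mul, hσ] at h1
      rw [show (2 * j + 1) / 2 = j by omega]
      push_cast
      exact h1
    · refine exists_intCast_eq_of_isIntegral_mul hn hσ ?_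
      rw [show (2 * j + 1 + 1) / 2 = j + 1 by omega]
      have : (σ ^ (2 * j + 1))⁻¹ = σ / n ^ (j + 1) := by
        rw [← hσ]
        field_simp
        ring
      rw [this] at h1
      push_cast
      rw [div_mul_eq_mul_div, ← mul_div_assoc'] at *
      exact h1
  choose! a ha using key
  exact ⟨a, ha⟩

/-! ### Homogeneous identities and gamma coefficients -/

theorem pow_mul_aeval_div {R : Type*} [CommRing R] [Algebra R ℂ] {p : R[X]} {E : ℕ}
    (hE : p.natDegree = E) (y : ℂ) {z : ℂ} (hz : z ≠ 0) :
    z ^ E * aeval (y / z) p =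
      ∑ k ∈ Finset.range (E + 1), algebraMap R ℂ (p.coeff (E - k)) * y ^ (E - k) * z ^ k := by
  rw [aeval_eq_sum_range, hE, Finset.mul_sum,
    ← Finset.sum_range_reflect _ (E + 1)]
  refine Finset.sum_congr rfl fun k hk => ?_
  have hk' : k ≤ E := Nat.lt_succ_iff.1 (Finset.mem_range.1 hk)
  rw [show E + 1 - 1 - k = E - k by omega, Algebra.smul_def, div_pow]
  have : z ^ E = z ^ k * z ^ (E - k) := by rw [← pow_add, Nat.add_sub_cancel' hk']
  rw [this]
  field_simp

/-- The terms of `∑ a_k √n^(-k) n^⌈k/2⌉ y^(E-k) z^k` with even `k` carry no square root of `n`,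
those with odd `k` carry exactly one. -/
theorem sum_eq_even_add_odd {E n : ℕ} (a : ℕ → ℤ) {σ : ℂ} (hσ : σ ^ 2 = n) (y z : ℂ) :
    ∑ k ∈ Finset.range (E + 1), ((a k : ℂ) * n ^ ((k + 1) / 2)) * (σ * y) ^ (E - k) * z ^ k =
      σ ^ E * (∑ k ∈ Finset.range (E + 1) with Even k, (a k : ℂ) * y ^ (E - k) * (z ^ 2) ^ (k / 2) +
        σ * z *
          ∑ k ∈ Finset.range (E + 1) with ¬Even k, (a k : ℂ) * y ^ (E - k) * (z ^ 2) ^ (k / 2)) := by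
  rw [← Finset.sum_filter_add_sum_filter_not (Finset.range (E + 1)) (fun k => Even k), mul_add,
    ← mul_assoc, Finset.mul_sum, Finset.mul_sum]
  congr 1
  · refine Finset.sum_congr rfl fun k hk => ?_
    obtain ⟨hk, he⟩ := Finset.mem_filter.1 hk
    have hk' : k ≤ E := Nat.lt_succ_iff.1 (Finset.mem_range.1 hk)
    have : σ ^ E = σ ^ k * σ ^ (E - k) := by rw [← pow_add, Nat.add_sub_cancel' hk']
    obtain ⟨j, rfl⟩ := he.two_dvd
    rw [this, ← hσ, show (2 * j + 1) / 2 = j by omega, show 2 * j / 2 = j by omega]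
    ring
  · refine Finset.sum_congr rfl fun k hk => ?_
    obtain ⟨hk, he⟩ := Finset.mem_filter.1 hk
    have hk' : k ≤ E := Nat.lt_succ_iff.1 (Finset.mem_range.1 hk)
    have : σ ^ E = σ ^ k * σ ^ (E - k) := by rw [← pow_add, Nat.add_sub_cancel' hk']
    obtain ⟨j, rfl⟩ := Nat.not_even_iff_odd.1 he
    rw [this, ← hσ, show (2 * j + 1 + 1) / 2 = j + 1 by omega, show (2 * j + 1) / 2 = j by omega]
    ring

/-- The homogeneous form of `p(x²) = g(x)² - n h(x)²`, where `f(√n x) / √n^E = g(x) + √n h(x)`. -/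
theorem sum_coeff_minpoly_eq_sq_sub {E n : ℕ} (hn : n ≠ 0) {u v : ℂ} (hu : IsIntegral ℚ u)
    (hv : IsIntegral ℤ v) (huv : u ^ 2 = n * v) (hfE : (minpoly ℚ u).natDegree = E)
    (hpE : (minpoly ℚ v).natDegree = E) {a : ℕ → ℤ}
    (ha : ∀ k ≤ E, (minpoly ℚ u).coeff (E - k) = a k * n ^ ((k + 1) / 2)) (y T : ℂ) :
    ∑ j ∈ Finset.range (E + 1), ((minpoly ℤ v).coeff (E - j) : ℂ) * y ^ (2 * E - 2 * j) * T ^ j =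
      (∑ k ∈ Finset.range (E + 1) with Even k, (a k : ℂ) * y ^ (E - k) * T ^ (k / 2)) ^ 2 - n * T *
        (∑ k ∈ Finset.range (E + 1) with ¬Even k, (a k : ℂ) * y ^ (E - k) * T ^ (k / 2)) ^ 2 := by
  have hpZ : minpoly ℚ v = (minpoly ℤ v).map (algebraMap ℤ ℚ) :=
    minpoly.isIntegrallyClosed_eq_field_fractions' ℚ hv
  have hpE' : (minpoly ℤ v).natDegree = E := by
    rw [← hpE, hpZ, natDegree_map_eq_of_injective (algebraMap ℤ ℚ).injective_int]
  rcases eq_or_ne T 0 with rfl | hT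
  · have hp0 : (minpoly ℤ v).coeff E = 1 := by
      rw [← hpE']; exact (minpoly.monic hv).coeff_natDegree
    have ha0 : a 0 = 1 := by
      have h := ha 0 (Nat.zero_le _)
      rw [Nat.sub_zero, ← hfE, (minpoly.monic hu).coeff_natDegree] at h
      simpa using h.symm
    rw [Finset.sum_eq_single_of_mem 0 (by simp), Finset.sum_eq_single_of_mem 0 (by simp)]
    · simp [hp0, ha0]; ring
    · intro k hk hk0
      obtain ⟨j, rfl⟩ := (Finset.mem_filter.1 hk).2.two_dvd
      rw [zero_pow (by omega), mul_zero]
    · intro k hk hk0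
      rw [zero_pow hk0, mul_zero]
  obtain ⟨z, rfl⟩ := IsAlgClosed.exists_pow_nat_eq T two_pos
  have hz : z ≠ 0 := by rintro rfl; exact hT (by simp)
  have hnC : (n : ℂ) ≠ 0 := Nat.cast_ne_zero.2 hn
  obtain ⟨σ, hσ⟩ := IsAlgClosed.exists_pow_nat_eq (n : ℂ) two_pos
  set A := ∑ k ∈ Finset.range (E + 1) with Even k, (a k : ℂ) * y ^ (E - k) * (z ^ 2) ^ (k / 2)
    with hA
  set B := ∑ k ∈ Finset.range (E + 1) with ¬Even k, (a k : ℂ) * y ^ (E - k) * (z ^ 2) ^ (k / 2)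
    with hB
  have hf : ∀ τ : ℂ, τ ^ 2 = n →
      z ^ E * aeval (τ * y / z) (minpoly ℚ u) = τ ^ E * (A + τ * z * B) := by
    intro τ hτ
    rw [pow_mul_aeval_div hfE _ hz, hA, hB, ← sum_eq_even_add_odd a hτ]
    refine Finset.sum_congr rfl fun k hk => ?_
    rw [ha k (Nat.lt_succ_iff.1 (Finset.mem_range.1 hk))]
    simp
  have h1 := hf σ hσ
  have h2 := hf (-σ) (by rw [neg_sq, hσ])
  have h3 := pow_mul_aeval_div hpE' (y ^ 2) hT
  have h4 := aeval_mul_aeval_neg hn hu huv hfE hpE hσ (y / z)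
  rw [hpZ, aeval_map_algebraMap] at h4
  rw [show σ * y / z = σ * (y / z) by ring] at h1
  rw [show -σ * y / z = -(σ * (y / z)) by ring] at h2
  rw [← div_pow] at h3
  have h5 : ∑ j ∈ Finset.range (E + 1),
      ((minpoly ℤ v).coeff (E - j) : ℂ) * y ^ (2 * E - 2 * j) * (z ^ 2) ^ j =
      (z ^ 2) ^ E * aeval ((y / z) ^ 2) (minpoly ℤ v) := by
    rw [h3]
    refine Finset.sum_congr rfl fun j _ => ?_
    rw [← pow_mul y, Nat.mul_sub]
    simp
  rw [h5]
  refine mul_left_cancel₀ (pow_ne_zero E (neg_ne_zero.2 hnC)) ?_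
  have h6 : (-n : ℂ) ^ E = σ ^ E * (-σ) ^ E := by rw [← mul_pow, ← hσ]; ring
  calc (-n : ℂ) ^ E * ((z ^ 2) ^ E * aeval ((y / z) ^ 2) (minpoly ℤ v))
      = (z ^ 2) ^ E * ((-n : ℂ) ^ E * aeval ((y / z) ^ 2) (minpoly ℤ v)) := by ring
    _ = (z ^ E * aeval (σ * (y / z)) (minpoly ℚ u)) *
          (z ^ E * aeval (-(σ * (y / z))) (minpoly ℚ u)) := by rw [← h4]; ring
    _ = _ := by rw [h1, h2, h6, ← hσ]; ring

/-- With `v = (1 + ζ)² / ζ`, both sides are monic of degree `φ(N)` and vanish at `ζ`. -/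
theorem cyclotomic_eq_sum_coeff_minpoly {N E : ℕ} (hN : 0 < N) (hE : 2 * E = N.totient) {ζ v : ℂ}
    (hζ : IsPrimitiveRoot ζ N) (hv : IsIntegral ℤ v) (hvζ : v = (1 + ζ) ^ 2 / ζ)
    (hpE : (minpoly ℤ v).natDegree = E) :
    cyclotomic N ℤ = ∑ j ∈ Finset.range (E + 1),
      C ((minpoly ℤ v).coeff (E - j)) * (X ^ j * (1 + X) ^ (2 * E - 2 * j)) := by
  set q := ∑ j ∈ Finset.range (E + 1),
    C ((minpoly ℤ v).coeff (E - j)) * (X ^ j * (1 + X) ^ (2 * E - 2 * j)) with hq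
  have hterm : ∀ j ∈ Finset.range (E + 1), (C ((minpoly ℤ v).coeff (E - j)) *
      (X ^ j * (1 + X) ^ (2 * E - 2 * j))).natDegree ≤ 2 * E - j := by
    intro j hj
    have hj' : j ≤ E := Nat.lt_succ_iff.1 (Finset.mem_range.1 hj)
    refine (natDegree_C_mul_le _ _).trans (natDegree_mul_le.trans ?_)
    have h1 : ((1 + X : ℤ[X]) ^ (2 * E - 2 * j)).natDegree ≤ (2 * E - 2 * j) * 1 :=
      natDegree_pow_le_of_le _ (by compute_degree)
    rw [natDegree_X_pow]
    omega
  have hdeg : q.natDegree ≤ 2 * E :=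
    natDegree_sum_le_of_forall_le _ _ fun j hj => (hterm j hj).trans (Nat.sub_le _ _)
  have hmonic : q.Monic := by
    refine monic_of_natDegree_le_of_coeff_eq_one _ hdeg ?_
    rw [hq, finsetSum_coeff, Finset.sum_eq_single_of_mem 0 (by simp)]
    · have : (minpoly ℤ v).coeff E = 1 := by rw [← hpE]; exact (minpoly.monic hv).coeff_natDegree
      simp [this, coeff_one_add_X_pow]
    · intro j hj hj0
      have := Finset.mem_range.1 hj
      exact coeff_eq_zero_of_natDegree_lt ((hterm j hj).trans_lt (by omega))
  have hroot : aeval ζ q = 0 := by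
    have h := pow_mul_aeval_div hpE ((1 + ζ) ^ 2) (hζ.ne_zero hN.ne')
    rw [← hvζ, minpoly.aeval, mul_zero] at h
    rw [hq, map_sum, h]
    refine Finset.sum_congr rfl fun j _ => ?_
    rw [← pow_mul, Nat.mul_sub]
    simp
    ring
  refine (eq_of_monic_of_dvd_of_natDegree_le (cyclotomic.monic N ℤ) hmonic ?_ ?_).symm
  · rw [cyclotomic_eq_minpoly hζ hN]
    exact minpoly.isIntegrallyClosed_dvd (hζ.isIntegral hN) hroot
  · rw [natDegree_cyclotomic, ← hE]
    exact hdeg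

open IntermediateField in
/-- The data from which both factors are built: gamma coefficients `γ` of `Φ_N`, and coefficients
`a` of the conjugate factors of `∑ γ_j y^(2E-2j) T^j` over `ℚ(√n)`. -/
theorem exists_gamma_eq_sq_sub {N n : ℕ} (hN : 3 ≤ N) (hn : Squarefree n) {ζ w : ℂ}
    (hζ : IsPrimitiveRoot ζ N) (hw : w ∈ ℚ⟮ζ⟯) (hw2 : w ^ 2 = n * ζ) :
    ∃ (E : ℕ) (a γ : ℕ → ℤ), 2 * E = N.totient ∧ a 0 = 1 ∧ γ 0 = 1 ∧ (∀ k, E < k → a k = 0) ∧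
      (∀ j, E < j → γ j = 0) ∧
      cyclotomic N ℤ =
        ∑ j ∈ Finset.range (E + 1), C (γ j) * (X ^ j * (1 + X) ^ (2 * E - 2 * j)) ∧
      ∀ y T : ℂ, ∑ j ∈ Finset.range (E + 1), (γ j : ℂ) * y ^ (2 * E - 2 * j) * T ^ j =
        (∑ k ∈ Finset.range (E + 1) with Even k, (a k : ℂ) * y ^ (E - k) * T ^ (k / 2)) ^ 2 -
          n * T *
          (∑ k ∈ Finset.range (E + 1) with ¬Even k, (a k : ℂ) * y ^ (E - k) * T ^ (k / 2)) ^ 2 := by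
  have hN0 : 0 < N := by omega
  have hζ0 : ζ ≠ 0 := hζ.ne_zero hN0.ne'
  have hn0 : (n : ℂ) ≠ 0 := Nat.cast_ne_zero.2 hn.ne_zero
  have hw0 : w ≠ 0 := by
    rintro rfl
    exact mul_ne_zero hn0 hζ0 (by simpa using hw2.symm)
  have hζc : (starRingEnd ℂ) ζ = ζ⁻¹ := by
    rw [Complex.inv_def, Complex.normSq_eq_norm_sq, hζ.norm'_eq_one hN0.ne']
    simp
  have hwc : (starRingEnd ℂ) w = n / w := by
    have h1 : ‖w‖ ^ 2 = n := by
      rw [← norm_pow, hw2, norm_mul, hζ.norm'_eq_one hN0.ne', mul_one, Complex.norm_natCast]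
    rw [eq_div_iff hw0, mul_comm, Complex.mul_conj, Complex.normSq_eq_norm_sq, h1]
    simp
  let u := w + n / w
  let v := ζ + ζ⁻¹ + 2
  have huv : u ^ 2 = n * v := by
    have : w ^ 2 * (n / w) ^ 2 = n ^ 2 := by field_simp
    have h2 : (n / w) ^ 2 = n * ζ⁻¹ := by
      rw [div_pow, hw2]; field_simp
    have h3 : w * (n / w) = n := by field_simp
    simp only [u, v]
    linear_combination hw2 + h2 + 2 * h3
  have hureal : u ∈ Set.range ((↑) : ℝ → ℂ) := by
    obtain ⟨r, hr⟩ := Complex.conj_eq_iff_real.1 (show (starRingEnd ℂ) u = u by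
      simp only [u, map_add, map_div₀, hwc, map_natCast]
      field_simp
      ring)
    exact ⟨r, hr.symm⟩
  have hvreal : v ∈ Set.range ((↑) : ℝ → ℂ) := by
    obtain ⟨r, hr⟩ := Complex.conj_eq_iff_real.1 (show (starRingEnd ℂ) v = v by
      simp only [v, map_add, map_inv₀, hζc, inv_inv, Complex.conj_ofNat]
      ring)
    exact ⟨r, hr.symm⟩
  have hζmem : ζ ∈ ℚ⟮ζ⟯ := mem_adjoin_simple_self ℚ ζ
  have hvmem : v ∈ ℚ⟮ζ⟯ := add_mem (add_mem hζmem (inv_mem hζmem)) (ofNat_mem _ 2)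
  have humem : u ∈ ℚ⟮ζ⟯ := add_mem hw (div_mem (_root_.natCast_mem _ n) hw)
  have hζint : IsIntegral ℤ ζ := hζ.isIntegral hN0
  have hvint : IsIntegral ℤ v :=
    (hζint.add (hζ.inv.isIntegral hN0)).add (isIntegral_algebraMap (R := ℤ) (x := 2))
  have huint : IsIntegral ℚ u := by
    refine IsIntegral.of_pow two_pos ?_
    rw [huv]
    exact (isIntegral_algebraMap (R := ℚ) (x := n)).mul hvint.tower_top
  have hvE := two_mul_natDegree_minpoly hN hζ hvmem hvreal (by
    have := sub_mem (mem_adjoin_simple_self ℚ v) (ofNat_mem ℚ⟮v⟯ 2)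
    simpa [v] using this)
  have huE := two_mul_natDegree_minpoly hN hζ humem hureal (by
    have h1 := sub_mem (div_mem (pow_mem (mem_adjoin_simple_self ℚ u) 2) (_root_.natCast_mem ℚ⟮u⟯ n))
      (ofNat_mem ℚ⟮u⟯ 2)
    rw [huv, mul_div_cancel_left₀ _ hn0] at h1
    simpa [v] using h1)
  set E := (minpoly ℚ v).natDegree with hE
  have huE' : (minpoly ℚ u).natDegree = E := by omega
  have hpE : (minpoly ℤ v).natDegree = E := by
    rw [hE, minpoly.isIntegrallyClosed_eq_field_fractions' ℚ hvint,
      natDegree_map_eq_of_injective (algebraMap ℤ ℚ).injective_int]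
  obtain ⟨a, ha⟩ := exists_coeff_minpoly_eq hn huint hvint huv huE' rfl
  have hid := sum_coeff_minpoly_eq_sq_sub hn.ne_zero huint hvint huv huE' rfl ha
  have hcyc := cyclotomic_eq_sum_coeff_minpoly hN0 hvE hζ hvint (v := v) (by
    simp only [v]; field_simp; ring) hpE
  refine ⟨E, fun k => if k ≤ E then a k else 0,
    fun j => if j ≤ E then (minpoly ℤ v).coeff (E - j) else 0, hvE, ?_, ?_, ?_, ?_, ?_, ?_⟩
  · have h := ha 0 (Nat.zero_le _)
    rw [Nat.sub_zero, ← huE', (minpoly.monic huint).coeff_natDegree] at h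
    simpa using h.symm
  · simp only [Nat.zero_le, if_true, Nat.sub_zero]
    rw [← hpE]
    exact (minpoly.monic hvint).coeff_natDegree
  · intro k hk
    exact if_neg (by omega)
  · intro k hk
    exact if_neg (by omega)
  · rw [hcyc]
    refine Finset.sum_congr rfl fun j hj => ?_
    dsimp only
    rw [if_pos (Nat.lt_succ_iff.1 (Finset.mem_range.1 hj))]
  · intro y T
    have hcongr : ∀ (S : Finset ℕ) (b : ℕ → ℤ) (c : ℕ → ℂ), S ⊆ Finset.range (E + 1) →
        ∑ j ∈ S, ((if j ≤ E then b j else 0 : ℤ) : ℂ) * c j = ∑ j ∈ S, (b j : ℂ) * c j := by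
      intro S b c hS
      refine Finset.sum_congr rfl fun j hj => ?_
      rw [if_pos (Nat.lt_succ_iff.1 (Finset.mem_range.1 (hS hj)))]
    have h := hid y T
    simp only [mul_assoc] at h ⊢
    rw [hcongr _ _ _ subset_rfl, hcongr _ _ _ (Finset.filter_subset _ _),
      hcongr _ _ _ (Finset.filter_subset _ _)]
    exact h

/-! ### Nonvanishing of the subleading coefficient -/

/-- Up to sign the coefficient is the Möbius function; only its parity is needed. -/
theorem odd_coeff_one_cyclotomic {N : ℕ} (hN : Squarefree N) :
    Odd ((cyclotomic N ℤ).coeff 1) := by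
  induction N using induction_on_primes with
  | zero => exact absurd hN not_squarefree_zero
  | one => simp [coeff_one]
  | prime_mul p a hp ih =>
    have ha : Squarefree a := hN.of_mul_right
    have hpa : ¬p ∣ a := fun h => hp.one_lt.ne' (Nat.isUnit_iff.1 (hN p (Nat.mul_dvd_mul_left p h)))
    have hpa2 : 2 ≤ a * p :=
      hp.two_le.trans (Nat.le_mul_of_pos_left p (Nat.pos_of_ne_zero ha.ne_zero))
    -- Compare the coefficients of `X` in `Φ_a(X^p) = Φ_{ap}(X) Φ_a(X)`.
    have h := congrArg (fun q => coeff q 1) (cyclotomic_expand_eq_cyclotomic_mul hp hpa ℤ)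
    simp only [coeff_expand hp.pos, Nat.dvd_one, hp.one_lt.ne', if_false, mul_coeff_one,
      cyclotomic_coeff_zero ℤ hpa2, one_mul] at h
    have h0 : Odd ((cyclotomic a ℤ).coeff 0) := by
      rcases (Nat.one_le_iff_ne_zero.2 ha.ne_zero).eq_or_lt with h1 | h1
      · simp [← h1]
      · simp [cyclotomic_coeff_zero ℤ h1]
    have h2 : Odd ((cyclotomic (a * p) ℤ).coeff 1 * (cyclotomic a ℤ).coeff 0) := by
      rw [show (cyclotomic (a * p) ℤ).coeff 1 * (cyclotomic a ℤ).coeff 0 =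
        -(cyclotomic a ℤ).coeff 1 by linarith]
      exact (ih ha).neg
    rw [mul_comm p a]
    exact (Int.odd_mul.1 h2).1

theorem coeff_sum_gamma {E : ℕ} {γ : ℕ → ℤ} (hγ : ∀ j, E < j → γ j = 0) (i : ℕ) :
    (∑ j ∈ Finset.range (E + 1), C (γ j) * (X ^ j * (1 + X) ^ (2 * E - 2 * j))).coeff i =
      ∑ j ∈ Finset.range (i + 1), γ j * ((2 * E - 2 * j).choose (i - j) : ℤ) := by
  -- Both sums run over the support of `c`, which vanishes for `j > E` and for `j > i`.
  let c : ℕ → ℤ := fun j => γ j * if j ≤ i then ((2 * E - 2 * j).choose (i - j) : ℤ) else 0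
  have h1 : ∑ j ∈ Finset.range (E + 1), c j = ∑ j ∈ Finset.range (E + 1 + (i + 1)), c j := by
    refine Finset.sum_subset (Finset.range_subset_range.2 (by omega)) fun j _ hj => ?_
    simp only [c]
    rw [hγ j (by simpa using hj), zero_mul]
  have h2 : ∑ j ∈ Finset.range (i + 1), c j = ∑ j ∈ Finset.range (E + 1 + (i + 1)), c j := by
    refine Finset.sum_subset (Finset.range_subset_range.2 (by omega)) fun j _ hj => ?_
    simp only [c]
    rw [if_neg (by simpa using hj), mul_zero]
  rw [finsetSum_coeff]
  have h3 : ∀ j ∈ Finset.range (i + 1),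
      γ j * ((2 * E - 2 * j).choose (i - j) : ℤ) = c j := fun j hj => by
    simp only [c]
    rw [if_pos (Nat.lt_succ_iff.1 (Finset.mem_range.1 hj))]
  rw [Finset.sum_congr rfl h3, h2, ← h1]
  refine Finset.sum_congr rfl fun j _ => ?_
  rw [coeff_C_mul, coeff_X_pow_mul', coeff_one_add_X_pow]

/-- The subleading coefficient `a 1` is seen by the first two coefficients of `Φ_N`: if `a 1 = 0`,
then `γ 1 = 2 a 2` and `γ 2 = 2 a 4 + (a 2)²`, which is incompatible with the parity
hypothesis. -/
theorem subleading_ne_zero {E N n : ℕ} {a γ : ℕ → ℤ} (ha0 : a 0 = 1) (hγ0 : γ 0 = 1)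
    (ha : ∀ k, E < k → a k = 0) (hγ : ∀ j, E < j → γ j = 0)
    (hcyc : cyclotomic N ℤ =
        ∑ j ∈ Finset.range (E + 1), C (γ j) * (X ^ j * (1 + X) ^ (2 * E - 2 * j)))
    (hid : ∀ y T : ℂ, ∑ j ∈ Finset.range (E + 1), (γ j : ℂ) * y ^ (2 * E - 2 * j) * T ^ j =
        (∑ k ∈ Finset.range (E + 1) with Even k, (a k : ℂ) * y ^ (E - k) * T ^ (k / 2)) ^ 2 -
          n * T *
          (∑ k ∈ Finset.range (E + 1) with ¬Even k, (a k : ℂ) * y ^ (E - k) * T ^ (k / 2)) ^ 2)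
    (hpar : Odd ((cyclotomic N ℤ).coeff 1) ∨
      (cyclotomic N ℤ).coeff 1 = 0 ∧ Odd ((cyclotomic N ℤ).coeff 2)) : a 1 ≠ 0 := by
  intro ha1
  -- The dehomogenization at `y = 1`, where low powers of `T` carry the leading coefficients.
  let p : ℤ[X] := ∑ j ∈ Finset.range (E + 1), C (γ j) * X ^ j
  let g : ℤ[X] := ∑ k ∈ Finset.range (E + 1) with Even k, C (a k) * X ^ (k / 2)
  let h : ℤ[X] := ∑ k ∈ Finset.range (E + 1) with ¬Even k, C (a k) * X ^ (k / 2)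
  have hpgh : p = g ^ 2 - C (n : ℤ) * (X * h ^ 2) := by
    refine map_injective (algebraMap ℤ ℂ) (algebraMap ℤ ℂ).injective_int
      (Polynomial.funext fun T => ?_)
    have := hid 1 T
    simp only [one_pow, mul_one] at this
    simpa [p, g, h, eval_finsetSum, Polynomial.map_sum, mul_assoc] using this
  have hp : ∀ i, p.coeff i = γ i := by
    intro i
    simp only [p, finsetSum_coeff, coeff_C_mul_X_pow, Finset.sum_ite_eq, Finset.mem_range]
    split_ifs with hi
    · rfl
    · exact (hγ i (by omega)).symm
  have hg : ∀ i, g.coeff i = a (2 * i) := by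
    intro i
    simp only [g, finsetSum_coeff, coeff_C_mul_X_pow]
    rw [Finset.sum_eq_single (2 * i)]
    · rw [if_pos (by omega)]
    · intro k hk hki
      obtain ⟨j, rfl⟩ := (Finset.mem_filter.1 hk).2.two_dvd
      rw [if_neg (by omega)]
    · intro hk
      rw [if_pos (by omega)]
      refine ha _ ?_
      by_contra hlt
      exact hk (Finset.mem_filter.2 ⟨Finset.mem_range.2 (by omega), even_two_mul i⟩)
  have hh : h.coeff 0 = 0 := by
    simp only [h, finsetSum_coeff, coeff_C_mul_X_pow]
    refine Finset.sum_eq_zero fun k hk => ?_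
    obtain ⟨j, rfl⟩ := Nat.not_even_iff_odd.1 (Finset.mem_filter.1 hk).2
    rcases j with _ | j
    · simp [ha1]
    · rw [if_neg (by omega)]
  have e1 : γ 1 = 2 * a 2 := by
    have := congrArg (fun q => coeff q 1) hpgh
    simp only [pow_two, hp, coeff_sub, mul_coeff_zero, mul_coeff_one, hg, hh] at this
    rw [this, mul_zero, ha0]
    ring
  have e2 : γ 2 = 2 * a 4 + a 2 ^ 2 := by
    have := congrArg (fun q => coeff q 2) hpgh
    simp only [pow_two, hp, coeff_sub, coeff_C_mul, coeff_X_mul, mul_coeff_one, coeff_mul g,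
      hg, hh, Finset.Nat.antidiagonal_succ] at this
    simp [ha0] at this
    rw [this]
    ring
  have c1 := coeff_sum_gamma hγ 1
  have c2 := coeff_sum_gamma hγ 2
  rw [← hcyc] at c1 c2
  simp only [Finset.sum_range_succ, Finset.sum_range_zero, hγ0, e1, e2] at c1 c2
  simp only [mul_zero, Nat.sub_zero, Nat.sub_self, Nat.choose_one_right, Nat.choose_zero_right,
    zero_add, one_mul, mul_one, Nat.cast_one, Nat.reduceSub] at c1 c2
  rcases hpar with hodd | ⟨h0, hodd⟩
  · rw [c1] at hodd
    obtain ⟨k, hk⟩ := hodd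
    push_cast at hk
    omega
  · have haE : a 2 = -E := by
      rw [c1] at h0
      push_cast at h0
      omega
    have hch : ((2 * E).choose 2 : ℤ) = E * (2 * E - 1) := by
      have h1 : (((2 * E).choose 2 : ℕ) : ℚ) = E * (2 * E - 1) := by
        rw [Nat.cast_choose_two]; push_cast; ring
      exact_mod_cast h1
    rw [c2, hch, haE] at hodd
    obtain ⟨k, hk⟩ := hodd
    -- With `a 2 = -E` the coefficient of `q²` is congruent to `E (2E - 1) + E²` modulo `2`.
    obtain ⟨r, hr⟩ := Int.even_mul_succ_self (E : ℤ)
    have : 2 * (k + E * ((2 * E - 2 * 1 : ℕ) : ℤ) - a 4 - 3 * r + 2 * E) + 1 = 0 := by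
      linear_combination -hk + 3 * hr
    omega

/-! ### From the coefficients to the Lucas atoms -/

/-- `Γ` may be computed from any gamma expansion of the right degree, by uniqueness. -/
theorem Gamma_eq_sum {p : ℂ[X]} (hp : IsPalindromic p) {d : ℕ} (hd : tdeg p = d) {γ : ℕ → ℂ}
    (h : p = ∑ j ∈ Finset.range (d / 2 + 1), C (γ j) * (X ^ j * (1 + X) ^ (d - 2 * j))) :
    Gamma p = ∑ j ∈ Finset.range (d / 2 + 1),
      MvPolynomial.C (γ j) * s ^ (d - 2 * j) * (-t) ^ j := by
  subst hd
  have hγ : gammaCoeff p hp = fun j : Fin (tdeg p / 2 + 1) => γ j := by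
    refine gammaExpansion_injective _ ?_
    refine (existsUnique_gammaExpansion hp).choose_spec.1.symm.trans ?_
    conv_lhs => rw [h, Finset.sum_range]
    rfl
  rw [Gamma, dif_pos hp, Finset.sum_range, hγ]

theorem tdeg_cyclotomic {N : ℕ} (hN : 2 ≤ N) : tdeg (cyclotomic N ℂ) = N.totient := by
  have : (cyclotomic N ℂ).natTrailingDegree = 0 :=
    natTrailingDegree_eq_zero.2 (Or.inr (by rw [cyclotomic_coeff_zero ℂ hN]; exact one_ne_zero))
  rw [tdeg, this, natDegree_cyclotomic, add_zero]

theorem sdeg_sum_monomial {S : Finset ℕ} {e b : ℕ → ℕ} {c : ℕ → ℤ} {k₀ : ℕ} (hk₀ : k₀ ∈ S)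
    (hc : c k₀ ≠ 0) (he : ∀ k ∈ S, k ≠ k₀ → e k < e k₀) :
    sdeg (∑ k ∈ S, MvPolynomial.monomial (Finsupp.single 0 (e k) + Finsupp.single 1 (b k)) (c k)) =
      e k₀ := by
  have hexp : ∀ k, (Finsupp.single 0 (e k) + Finsupp.single 1 (b k) : Fin 2 →₀ ℕ) 0 = e k := by
    intro k; simp
  refine le_antisymm ?_ ?_
  · refine MvPolynomial.degreeOf_le_iff.2 fun m hm => ?_
    obtain ⟨k, hk, hmk⟩ := Finset.mem_biUnion.1 (MvPolynomial.support_sum hm)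
    rw [Finset.mem_singleton.1 (MvPolynomial.support_monomial_subset hmk), hexp]
    rcases eq_or_ne k k₀ with rfl | hne
    · rfl
    · exact (he k hk hne).le
  · rw [← hexp k₀]
    refine MvPolynomial.monomial_le_degreeOf 0 (MvPolynomial.mem_support_iff.2 ?_)
    rw [MvPolynomial.coeff_sum, Finset.sum_eq_single_of_mem k₀ hk₀]
    · rwa [MvPolynomial.coeff_monomial, if_pos rfl]
    · intro k hk hne
      rw [MvPolynomial.coeff_monomial, if_neg]
      intro h
      have := DFunLike.congr_fun h 0
      rw [hexp, hexp] at this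
      exact (he k hk hne).ne this

open IntermediateField in
/-- The decomposition for any `N` whose cyclotomic field contains a square root of `n ζ`. The
parity hypothesis serves to determine the degree of `H` in `s`. -/
theorem lucasAtom_eq_sq_add {N n : ℕ} (hN : 3 ≤ N) (hn : Squarefree n) {ζ w : ℂ}
    (hζ : IsPrimitiveRoot ζ N) (hw : w ∈ ℚ⟮ζ⟯) (hw2 : w ^ 2 = n * ζ)
    (hpar : Odd ((cyclotomic N ℤ).coeff 1) ∨
      (cyclotomic N ℤ).coeff 1 = 0 ∧ Odd ((cyclotomic N ℤ).coeff 2)) :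
    ∃ G H : MvPolynomial (Fin 2) ℤ,
      lucasAtom N = MvPolynomial.map (Int.castRingHom ℂ) G ^ 2
        + (n : MvPolynomial (Fin 2) ℂ) * t * MvPolynomial.map (Int.castRingHom ℂ) H ^ 2 ∧
      sdeg G = N.totient / 2 ∧ sdeg H = N.totient / 2 - 1 := by
  obtain ⟨E, a, γ, hE, ha0, hγ0, ha, hγ, hcyc, hid⟩ := exists_gamma_eq_sq_sub hN hn hζ hw hw2
  have ha1 := subleading_ne_zero ha0 hγ0 ha hγ hcyc hid hpar
  have hE1 : 1 ≤ E := by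
    by_contra hlt
    exact ha1 (ha 1 (by omega))
  have hE2 : N.totient / 2 = E := by omega
  let term : ℕ → MvPolynomial (Fin 2) ℤ := fun k => MvPolynomial.monomial
    (Finsupp.single 0 (E - k) + Finsupp.single 1 (k / 2)) (a k * (-1) ^ (k / 2))
  have heval : ∀ (x : Fin 2 → ℂ) (k : ℕ),
      MvPolynomial.eval x (MvPolynomial.map (Int.castRingHom ℂ) (term k)) =
        (a k : ℂ) * x 0 ^ (E - k) * (-x 1) ^ (k / 2) := by
    intro x k
    simp only [term, MvPolynomial.map_monomial, MvPolynomial.eval_monomial]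
    rw [Finsupp.prod_add_index' (by simp) (by intros; rw [pow_add]), neg_pow (x 1)]
    simp
    ring
  refine ⟨∑ k ∈ Finset.range (E + 1) with Even k, term k,
    ∑ k ∈ Finset.range (E + 1) with ¬Even k, term k, ?_, ?_, ?_⟩
  · have hcycC : cyclotomic N ℂ = ∑ j ∈ Finset.range (N.totient / 2 + 1),
        C (γ j : ℂ) * (X ^ j * (1 + X) ^ (N.totient - 2 * j)) := by
      rw [← map_cyclotomic_int, hcyc, Polynomial.map_sum, hE2, ← hE]
      simp
    rw [lucasAtom, if_neg (by omega), Gamma_eq_sum (isPalindromic_cyclotomic (by omega))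
      (tdeg_cyclotomic (by omega)) hcycC, hE2, ← hE]
    refine MvPolynomial.funext fun x => ?_
    have h := hid (x 0) (-x 1)
    simp only [map_sum, map_mul, map_pow, map_add, map_neg, map_natCast, MvPolynomial.eval_C,
      MvPolynomial.eval_X, heval]
    rw [h]
    ring
  · rw [hE2]
    refine (sdeg_sum_monomial (k₀ := 0) (by simp) (by simp [ha0]) ?_).trans (Nat.sub_zero E)
    intro k hk hk0
    omega
  · rw [hE2]
    refine sdeg_sum_monomial (k₀ := 1) (by simp; omega) (by simpa using ha1) ?_
    intro k hk hk1
    obtain ⟨hk, hodd⟩ := Finset.mem_filter.1 hk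
    have := Finset.mem_range.1 hk
    have := Nat.odd_iff.1 (Nat.not_even_iff_odd.1 hodd)
    omega

end LucasAtoms


open LucasAtoms in
theorem theorem4p2 (n : ℕ) (hsq : Squarefree n) :
    (5 ≤ n → n ≡ 1 [MOD 4] →
      ∃ G H : MvPolynomial (Fin 2) ℤ,
        lucasAtom n = MvPolynomial.map (Int.castRingHom ℂ) G ^ 2
          + (n : MvPolynomial (Fin 2) ℂ) * t * MvPolynomial.map (Int.castRingHom ℂ) H ^ 2 ∧
        sdeg G = Nat.totient n / 2 ∧
        sdeg H = Nat.totient n / 2 - 1) ∧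
    (4 ≤ n → Even n →
      ∃ G H : MvPolynomial (Fin 2) ℤ,
        lucasAtom (2 * n) = MvPolynomial.map (Int.castRingHom ℂ) G ^ 2
          + (n : MvPolynomial (Fin 2) ℂ) * t * MvPolynomial.map (Int.castRingHom ℂ) H ^ 2 ∧
        sdeg G = Nat.totient (2 * n) / 2 ∧
        sdeg H = Nat.totient (2 * n) / 2 - 1) := by
  refine ⟨fun h5 hmod => ?_, fun h4 heven => ?_⟩
  · obtain ⟨ζ, w, hζ, hw, hw2⟩ := exists_sq_eq_mul_root_of_mod_four_eq_one hmod
    exact lucasAtom_eq_sq_add (by omega) hsq hζ hw hw2 (Or.inl (odd_coeff_one_cyclotomic hsq))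
  · obtain ⟨m, rfl⟩ := heven.two_dvd
    have hm : Odd m := by
      rw [← Nat.not_even_iff_odd]
      intro h
      have := Nat.isUnit_iff.1 (hsq 2 (Nat.mul_dvd_mul_left 2 h.two_dvd))
      omega
    obtain ⟨ζ, w, hζ, hw, hw2⟩ := exists_sq_eq_mul_root_of_even hm
    rw [show 4 * m = 2 * (2 * m) by ring] at hζ
    -- `Φ_{2n}(q) = Φ_n(q²)` because `n` is even.
    have hexp : cyclotomic (2 * (2 * m)) ℤ = Polynomial.expand ℤ 2 (cyclotomic (2 * m) ℤ) := by
      rw [cyclotomic_expand_eq_cyclotomic Nat.prime_two (Nat.dvd_mul_right 2 m), mul_comm (2 * m)]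
    refine lucasAtom_eq_sq_add (by omega) hsq hζ hw hw2 (Or.inr ⟨?_, ?_⟩)
    · rw [hexp, coeff_expand two_pos, if_neg (by decide)]
    · rw [hexp, coeff_expand two_pos, if_pos dvd_rfl]
      exact odd_coeff_one_cyclotomic hsq
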